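/- Let $P$ be a finite set of points in the unit square $[0,1]^2$. A \emph{lower-left anchored square packing} for $P$ is a family of closed axis-aligned squares $(s_p)_{p\in P}$ contained in $[0,1]^2$ (squares of side length $0$ are allowed) such that $p$ is the lower-left corner of $s_p$ for every $p\in P$, no point of $P$ lies in the interior of any of the squares, and the squares are pairwise interior-disjoint. Its area is $\sum_{p\in P}\mathrm{area}(s_p)$, and it is \emph{optimal} if no lower-left anchored square packing for $P$ has larger area. The \emph{greedy algorithm} works as follows. Set $Q=P$ and $S=\emptyset$. While $Q\neq\emptyset$, repeat: for each $q\in Q$ let a candidate $s(q)$ be a square of maximum area among the squares that are contained in $[0,1]^2$, have $q$ as their lower-left corner, have no point of $P$ in their interior, and are interior-disjoint from all squares in $S$; choose a point $q\in Q$ whose candidate is largest (ties are broken arbitrarily); replace $Q$ by $Q\setminus\{q\}$ and $S$ by $S\cup\{s(q)\}$. When $Q=\emptyset$, return $S$. \textbf{Theorem.} (i) For every finite $P\subset[0,1]^2$ the greedy algorithm has an output, an optimal packing exists, and every possible output of the greedy algorithm is a lower-left anchored square packing for $P$ whose area is at least $\frac13$ times the area of an optimal packing for $P$. (ii) The constant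 $\frac13$ is best possible for this algorithm: for every $\varepsilon>0$ there is a finite set $P\subset[0,1]^2$ such that, however ties are broken, the area of the packing returned by the greedy algorithm is less than $\left(\frac13+\varepsilon\right)$ times the area of an optimal packing for $P$. -/

import Mathlib

/-- The unit square `[0,1]²`. -/
def unitSquare : Set (ℝ × ℝ) := Set.Icc (0 : ℝ) 1 ×ˢ Set.Icc (0 : ℝ) 1

/-- A closed axis-aligned square, given by its lower-left corner (its anchor) and its side
length. Side length `0`, a single point, is allowed. -/
@[ext] structure LLSquare where
  anchor : ℝ × ℝ
  side : ℝ
  side_nonneg : 0 ≤ side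

namespace LLSquare

/-- The points of the square. -/
def toSet (s : LLSquare) : Set (ℝ × ℝ) :=
  Set.Icc s.anchor.1 (s.anchor.1 + s.side) ×ˢ Set.Icc s.anchor.2 (s.anchor.2 + s.side)

def area (s : LLSquare) : ℝ := s.side ^ 2

/-- The elementary area is the two-dimensional Lebesgue measure of the square. -/
theorem area_eq_volume (s : LLSquare) :
    MeasureTheory.volume s.toSet = ENNReal.ofReal s.area := by
  rw [toSet, MeasureTheory.Measure.volume_eq_prod, MeasureTheory.Measure.prod_prod,
    Real.volume_Icc, Real.volume_Icc, area, sq, ENNReal.ofReal_mul s.side_nonneg]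
  simp

/-- No point of `P` lies in the interior of the square. -/
def IsEmptyOf (s : LLSquare) (P : Finset (ℝ × ℝ)) : Prop :=
  ∀ p ∈ P, p ∉ interior s.toSet

def InteriorDisjoint (s t : LLSquare) : Prop :=
  Disjoint (interior s.toSet) (interior t.toSet)

end LLSquare

/-- The total area of a finite set of squares. -/
def totalArea (S : Finset LLSquare) : ℝ := ∑ s ∈ S, s.area

/-- `S` is a lower-left anchored square packing for `P`: it has exactly one square for each point
of `P`, with that point as its lower-left corner, and no others; the squares lie in the unit
square, have no point of `P` in their interiors, and are pairwise interior-disjoint. -/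
structure IsLLPacking (P : Finset (ℝ × ℝ)) (S : Finset LLSquare) : Prop where
  anchor_mem : ∀ s ∈ S, s.anchor ∈ P
  existsUnique : ∀ p ∈ P, ∃! s, s ∈ S ∧ s.anchor = p
  subset_unitSquare : ∀ s ∈ S, s.toSet ⊆ unitSquare
  isEmptyOf : ∀ s ∈ S, s.IsEmptyOf P
  interiorDisjoint : ∀ s ∈ S, ∀ t ∈ S, s ≠ t → s.InteriorDisjoint t

/-- A lower-left anchored square packing for `P` of maximum total area. -/
def IsOptimalLLPacking (P : Finset (ℝ × ℝ)) (S : Finset LLSquare) : Prop :=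
  IsLLPacking P S ∧ ∀ T, IsLLPacking P T → totalArea T ≤ totalArea S

/-- `s` may be placed at `q` when the squares in `S` have been chosen. -/
structure IsAdmissible (P : Finset (ℝ × ℝ)) (S : Finset LLSquare) (q : ℝ × ℝ)
    (s : LLSquare) : Prop where
  anchor_eq : s.anchor = q
  subset_unitSquare : s.toSet ⊆ unitSquare
  isEmptyOf : s.IsEmptyOf P
  interiorDisjoint : ∀ t ∈ S, s.InteriorDisjoint t

/-- `s` is the candidate square of `q`: an admissible square of maximum area. -/
def IsCandidate (P : Finset (ℝ × ℝ)) (S : Finset LLSquare) (q : ℝ × ℝ) (s : LLSquare) : Prop :=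
  IsAdmissible P S q s ∧ ∀ s', IsAdmissible P S q s' → s'.area ≤ s.area

open Classical in
/-- The states `(Q, S)` that the greedy algorithm can reach on input `P`, where `Q` is the set of
points still to be processed and `S` is the set of squares chosen so far. Each step chooses a
largest one among the candidate squares of the points of `Q`; ties are broken arbitrarily. -/
inductive GreedyReaches (P : Finset (ℝ × ℝ)) : Finset (ℝ × ℝ) → Finset LLSquare → Prop
  | init : GreedyReaches P P ∅
  | step {Q : Finset (ℝ × ℝ)} {S : Finset LLSquare} {q : ℝ × ℝ} {s : LLSquare} :
      GreedyReaches P Q S → q ∈ Q → IsCandidate P S q s →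
      (∀ q' ∈ Q, ∀ s', IsCandidate P S q' s' → s'.area ≤ s.area) →
      GreedyReaches P (Q.erase q) (insert s S)

/-- `S` is returned by some run of the greedy algorithm on input `P`. -/
def IsGreedyOutput (P : Finset (ℝ × ℝ)) (S : Finset LLSquare) : Prop :=
  GreedyReaches P ∅ S

/-! For the lower bound, start from the sides of any packing and follow the greedy run, shrinking
the packing so that it stays disjoint from the greedy squares. A shrunk square at an unprocessed
point is admissible, so its side is at most the side `a` of the square chosen next. Clearing room
for that square costs at most `3 * a ^ 2` (`exists_shrink`). At the end every point is processed and
every side is `0`, so the original area is at most three times the greedy area.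

The cost splits as `1 + 1 + 1`. By emptiness, a square meeting the new one crosses its left or its
bottom side. At most one protrudes past the upper-left corner and at most one past the lower-right
corner, each losing at most `a ^ 2`. All the others together lose at most `a ^ 2`
(`sum_sub_sq_le_sq`), by comparing overlap areas with an L-shaped region.

For sharpness, three quadrants give area `3 / 4`, while greedy starts with a square at the origin
slightly larger than a quadrant. This ruins the other two quadrants, and closely spaced diagonal
points make the fourth nearly worthless. -/

open MeasureTheory

/-! ### Open squares: overlap criterion and areas -/

/-- The open axis-aligned square with lower-left corner `p` and side length `r`. -/
def openSq (p : ℝ × ℝ) (r : ℝ) : Set (ℝ × ℝ) :=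
  Set.Ioo p.1 (p.1 + r) ×ˢ Set.Ioo p.2 (p.2 + r)

theorem mem_openSq {x p : ℝ × ℝ} {r : ℝ} :
    x ∈ openSq p r ↔ (p.1 < x.1 ∧ x.1 < p.1 + r) ∧ p.2 < x.2 ∧ x.2 < p.2 + r := Iff.rfl

theorem LLSquare.interior_toSet (s : LLSquare) :
    interior s.toSet = openSq s.anchor s.side := by
  rw [LLSquare.toSet, interior_prod_eq, interior_Icc, interior_Icc, openSq]

theorem openSq_mono {p : ℝ × ℝ} {r r' : ℝ} (h : r ≤ r') : openSq p r ⊆ openSq p r' := by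
  intro x hx
  rw [mem_openSq] at hx ⊢
  exact ⟨⟨hx.1.1, by linarith⟩, hx.2.1, by linarith⟩

theorem not_disjoint_openSq {p q : ℝ × ℝ} {r a : ℝ} :
    ¬ Disjoint (openSq q r) (openSq p a) ↔
      (0 < r ∧ 0 < a) ∧ (q.1 < p.1 + a ∧ p.1 < q.1 + r) ∧ q.2 < p.2 + a ∧ p.2 < q.2 + r := by
  rw [openSq, openSq, Set.disjoint_prod, Set.Ioo_disjoint_Ioo, Set.Ioo_disjoint_Ioo]
  simp only [not_or, not_le, lt_min_iff, max_lt_iff]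
  constructor
  · rintro ⟨⟨⟨h1, h2⟩, h3, h4⟩, ⟨h5, h6⟩, h7, h8⟩
    refine ⟨⟨by linarith, by linarith⟩, ⟨by linarith, by linarith⟩, by linarith, by linarith⟩
  · rintro ⟨⟨h1, h2⟩, ⟨h3, h4⟩, h5, h6⟩
    refine ⟨⟨⟨?_, ?_⟩, ?_, ?_⟩, ⟨?_, ?_⟩, ?_, ?_⟩ <;> linarith

theorem measurableSet_openSq (p : ℝ × ℝ) (r : ℝ) : MeasurableSet (openSq p r) :=
  measurableSet_Ioo.prod measurableSet_Ioo

theorem volume_real_Ioo_prod_Ioo {a b c d : ℝ} (h : a ≤ b) (h' : c ≤ d) :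
    volume.real (Set.Ioo a b ×ˢ Set.Ioo c d) = (b - a) * (d - c) := by
  rw [Measure.volume_eq_prod, measureReal_prod_prod, Real.volume_real_Ioo_of_le h,
    Real.volume_real_Ioo_of_le h']

theorem volume_real_Icc_prod_Icc {a b c d : ℝ} (h : a ≤ b) (h' : c ≤ d) :
    volume.real (Set.Icc a b ×ˢ Set.Icc c d) = (b - a) * (d - c) := by
  rw [Measure.volume_eq_prod, measureReal_prod_prod, Real.volume_real_Icc_of_le h,
    Real.volume_real_Icc_of_le h']

/-- The part inside `openSq p a` of an open square that starts on or to the left of the left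
side, and vertically stays within the extent of `openSq p a`. -/
theorem volume_real_inter_left {p q : ℝ × ℝ} {a r : ℝ} (h1 : q.1 ≤ p.1) (h2 : p.1 ≤ q.1 + r)
    (hra : r ≤ a) (h3 : p.2 ≤ q.2) (h4 : q.2 + r ≤ p.2 + a) :
    volume.real (openSq q r ∩ openSq p a) = (r - (p.1 - q.1)) * r := by
  rw [openSq, openSq, Set.prod_inter_prod, Set.Ioo_inter_Ioo, Set.Ioo_inter_Ioo,
    sup_eq_right.2 h1, sup_eq_left.2 h3, inf_eq_left.2 h4,
    inf_eq_left.2 (by linarith : q.1 + r ≤ p.1 + a),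
    volume_real_Ioo_prod_Ioo h2 (by linarith)]
  ring

theorem volume_real_inter_bottom {p q : ℝ × ℝ} {a r : ℝ} (h1 : q.2 ≤ p.2) (h2 : p.2 ≤ q.2 + r)
    (hra : r ≤ a) (h3 : p.1 ≤ q.1) (h4 : q.1 + r ≤ p.1 + a) :
    volume.real (openSq q r ∩ openSq p a) = (r - (p.2 - q.2)) * r := by
  rw [openSq, openSq, Set.prod_inter_prod, Set.Ioo_inter_Ioo, Set.Ioo_inter_Ioo,
    sup_eq_right.2 h1, sup_eq_left.2 h3, inf_eq_left.2 h4,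
    inf_eq_left.2 (by linarith : q.2 + r ≤ p.2 + a),
    volume_real_Ioo_prod_Ioo (by linarith) h2]
  ring

/-! ### Area lost by making room for one square -/

theorem sum_measureReal_le_of_subset {ι α : Type*} [MeasurableSpace α] {μ : Measure α}
    (J : Finset ι) (R : ι → Set α) {U : Set α} (hU : μ U ≠ ⊤)
    (hR : ∀ i ∈ J, MeasurableSet (R i)) (hd : (J : Set ι).PairwiseDisjoint R)
    (hsub : ∀ i ∈ J, R i ⊆ U) : ∑ i ∈ J, μ.real (R i) ≤ μ.real U := by
  rw [← measureReal_biUnion_finset hd hR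
    (fun i hi => ne_top_of_le_ne_top hU (measure_mono (hsub i hi)))]
  exact measureReal_mono (Set.iUnion₂_subset hsub) hU

/-- Take the maximum of `d`, or `0` if `J` is empty. It serves as the greatest depth to which
squares enter through one side. -/
theorem exists_bound_sq_le_sum_sq {ι : Type*} (J : Finset ι) (d : ι → ℝ) {a : ℝ} (ha : 0 ≤ a)
    (hd : ∀ i ∈ J, 0 ≤ d i ∧ d i ≤ a) :
    ∃ D, 0 ≤ D ∧ D ≤ a ∧ (∀ i ∈ J, d i ≤ D) ∧ D ^ 2 ≤ ∑ i ∈ J, d i ^ 2 := by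
  rcases J.eq_empty_or_nonempty with rfl | hJ
  · exact ⟨0, le_rfl, ha, by simp, by simp⟩
  · obtain ⟨i, hi, hmax⟩ := J.exists_max_image d hJ
    exact ⟨d i, (hd i hi).1, (hd i hi).2, hmax,
      Finset.single_le_sum (f := fun i => d i ^ 2) (fun j _ => sq_nonneg _) hi⟩

/-- Squares crossing the left side (`A`) or the bottom side (`B`) of the square at `p` of side `a`
without protruding beyond its upper-left and lower-right corners. -/
theorem sum_sub_sq_le_sq {p : ℝ × ℝ} {a : ℝ} (ha : 0 ≤ a) {A B : Finset (ℝ × ℝ)}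
    {r : ℝ × ℝ → ℝ} (hAB : Disjoint A B)
    (hd : ((A ∪ B : Finset (ℝ × ℝ)) : Set (ℝ × ℝ)).PairwiseDisjoint fun q => openSq q (r q))
    (hr : ∀ q ∈ A ∪ B, r q ≤ a)
    (hA : ∀ q ∈ A, q.1 ≤ p.1 ∧ p.1 ≤ q.1 + r q ∧ p.2 ≤ q.2 ∧ q.2 + r q ≤ p.2 + a)
    (hB : ∀ q ∈ B, q.2 ≤ p.2 ∧ p.2 ≤ q.2 + r q ∧ p.1 ≤ q.1 ∧ q.1 + r q ≤ p.1 + a) :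
    ∑ q ∈ A, (r q ^ 2 - (p.1 - q.1) ^ 2) + ∑ q ∈ B, (r q ^ 2 - (p.2 - q.2) ^ 2) ≤ a ^ 2 := by
  obtain ⟨D, hD0, hDa, hD, hDs⟩ := exists_bound_sq_le_sum_sq A (fun q => r q - (p.1 - q.1)) ha
    (fun q hq => ⟨by linarith [hA q hq], by linarith [hA q hq, hr q (Finset.mem_union_left _ hq)]⟩)
  obtain ⟨E, hE0, hEa, hE, hEs⟩ := exists_bound_sq_le_sum_sq B (fun q => r q - (p.2 - q.2)) ha
    (fun q hq => ⟨by linarith [hB q hq], by linarith [hB q hq, hr q (Finset.mem_union_right _ hq)]⟩)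
  -- All overlaps lie in an L-shape: a vertical strip of width `D` and the rest of a horizontal
  -- strip of height `E`.
  set U₁ := Set.Icc p.1 (p.1 + D) ×ˢ Set.Icc p.2 (p.2 + a)
  set U₂ := Set.Icc (p.1 + D) (p.1 + a) ×ˢ Set.Icc p.2 (p.2 + E)
  have hU : volume (U₁ ∪ U₂) ≠ ⊤ :=
    ((isCompact_Icc.prod isCompact_Icc).union (isCompact_Icc.prod isCompact_Icc)).measure_lt_top.ne
  have hvol : volume.real (U₁ ∪ U₂) ≤ D * a + (a - D) * E := by
    refine (measureReal_union_le _ _).trans_eq ?_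
    rw [volume_real_Icc_prod_Icc (by linarith) (by linarith),
      volume_real_Icc_prod_Icc (by linarith) (by linarith)]
    ring
  have key := sum_measureReal_le_of_subset (A ∪ B) (fun q => openSq q (r q) ∩ openSq p a) hU
    (fun q _ => (measurableSet_openSq _ _).inter (measurableSet_openSq _ _))
    (fun q hq q' hq' hne => (hd hq hq' hne).mono Set.inter_subset_left Set.inter_subset_left)
    (by
      intro q hq x hx
      obtain ⟨hx1, hx2⟩ := hx
      rw [mem_openSq] at hx1 hx2
      rcases Finset.mem_union.1 hq with hq | hq
      · have := hD q hq
        exact Or.inl ⟨⟨by linarith, by linarith⟩, by linarith, by linarith⟩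
      · have := hE q hq
        rcases le_total x.1 (p.1 + D) with h | h
        · exact Or.inl ⟨⟨by linarith, by linarith⟩, by linarith, by linarith⟩
        · exact Or.inr ⟨⟨by linarith, by linarith⟩, by linarith, by linarith⟩)
  rw [Finset.sum_union hAB,
    Finset.sum_congr rfl fun q hq => volume_real_inter_left (hA q hq).1 (hA q hq).2.1
      (hr q (Finset.mem_union_left _ hq)) (hA q hq).2.2.1 (hA q hq).2.2.2,
    Finset.sum_congr rfl fun q hq => volume_real_inter_bottom (hB q hq).1 (hB q hq).2.1
      (hr q (Finset.mem_union_right _ hq)) (hB q hq).2.2.1 (hB q hq).2.2.2] at key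
  -- A square of side `r` entering to depth `d` overlaps in area `d * r` and loses `r ^ 2 - (r - d)
  -- ^ 2 = 2 * d * r - d ^ 2`.
  have e1 : ∑ q ∈ A, (r q ^ 2 - (p.1 - q.1) ^ 2) =
      2 * ∑ q ∈ A, (r q - (p.1 - q.1)) * r q - ∑ q ∈ A, (r q - (p.1 - q.1)) ^ 2 := by
    rw [Finset.mul_sum, ← Finset.sum_sub_distrib]
    exact Finset.sum_congr rfl fun q _ => by ring
  have e2 : ∑ q ∈ B, (r q ^ 2 - (p.2 - q.2) ^ 2) =
      2 * ∑ q ∈ B, (r q - (p.2 - q.2)) * r q - ∑ q ∈ B, (r q - (p.2 - q.2)) ^ 2 := by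
    rw [Finset.mul_sum, ← Finset.sum_sub_distrib]
    exact Finset.sum_congr rfl fun q _ => by ring
  rw [e1, e2]
  -- The loss is at most `2 * (D * a + (a - D) * E) - D ^ 2 - E ^ 2 = a ^ 2 - (a - D - E) ^ 2`.
  nlinarith [sq_nonneg (a - D - E)]

theorem sum_le_of_card_le_one {ι : Type*} {J : Finset ι} {g : ι → ℝ} {c : ℝ} (hc : 0 ≤ c)
    (hJ : ∀ i ∈ J, ∀ j ∈ J, i = j) (hg : ∀ i ∈ J, g i ≤ c) : ∑ i ∈ J, g i ≤ c := by
  rcases J.eq_empty_or_nonempty with rfl | ⟨i, hi⟩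
  · simpa
  · rw [Finset.eq_singleton_iff_unique_mem.2 ⟨hi, fun j hj => hJ j hj i hi⟩, Finset.sum_singleton]
    exact hg i hi

/-- If a square of side `a` is added at `p`, then interior-disjoint squares of side at most `a`
can be shrunk to avoid it at the cost of a total area of at most `3 * a ^ 2`. -/
theorem exists_shrink {p : ℝ × ℝ} {a : ℝ} (ha : 0 ≤ a) {J : Finset (ℝ × ℝ)}
    {r : ℝ × ℝ → ℝ} (hr0 : ∀ q ∈ J, 0 ≤ r q) (hra : ∀ q ∈ J, r q ≤ a)
    (hd : (J : Set (ℝ × ℝ)).PairwiseDisjoint fun q => openSq q (r q))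
    (hp : ∀ q ∈ J, p ∉ openSq q (r q)) (hq : ∀ q ∈ J, q ∉ openSq p a) :
    ∃ r' : ℝ × ℝ → ℝ,
      (∀ q ∈ J, 0 ≤ r' q ∧ r' q ≤ r q ∧ Disjoint (openSq q (r' q)) (openSq p a)) ∧
      ∑ q ∈ J, r q ^ 2 - ∑ q ∈ J, r' q ^ 2 ≤ 3 * a ^ 2 := by
  classical
  -- For an overlapping square, the maximum is the largest side that avoids the new square: it pulls
  -- back to the left or bottom side that was crossed.
  set r' : ℝ × ℝ → ℝ := fun q =>
    if Disjoint (openSq q (r q)) (openSq p a) then r q else max (p.1 - q.1) (p.2 - q.2) with hr'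
  have hover : ∀ q ∈ J, ¬ Disjoint (openSq q (r q)) (openSq p a) →
      (q.1 < p.1 + a ∧ p.1 < q.1 + r q ∧ q.2 < p.2 + a ∧ p.2 < q.2 + r q) ∧
      ((q.1 ≤ p.1 ∧ p.2 ≤ q.2) ∨ (q.2 ≤ p.2 ∧ p.1 ≤ q.1)) := by
    intro q hqJ hnd
    rw [not_disjoint_openSq] at hnd
    obtain ⟨_, ⟨h1, h2⟩, h3, h4⟩ := hnd
    refine ⟨⟨h1, h2, h3, h4⟩, ?_⟩
    have h5 := hp q hqJ
    have h6 := hq q hqJ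
    rw [mem_openSq] at h5 h6
    -- Otherwise `q` is strictly below and left of `p`, so `p` is inside the square at `q`, or
    -- strictly above and right, so `q` is inside the new square.
    by_contra hcon
    push Not at hcon
    obtain ⟨c1, c2⟩ := hcon
    rcases le_or_gt q.1 p.1 with h | h
    · have c3 := c1 h
      rcases h.eq_or_lt with h' | h'
      · linarith [c2 c3.le]
      · exact h5 ⟨⟨h', h2⟩, c3, h4⟩
    · have : p.2 < q.2 := by
        by_contra h7
        linarith [c2 (not_lt.1 h7)]
      exact h6 ⟨⟨h, h1⟩, this, h3⟩
  refine ⟨r', ?_, ?_⟩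
  · intro q hqJ
    by_cases hdis : Disjoint (openSq q (r q)) (openSq p a)
    · simp only [hr', if_pos hdis]
      exact ⟨hr0 q hqJ, le_rfl, hdis⟩
    · simp only [hr', if_neg hdis]
      obtain ⟨⟨h1, h2, h3, h4⟩, h5⟩ := hover q hqJ hdis
      refine ⟨?_, max_le (by linarith) (by linarith), ?_⟩
      · rcases h5 with h5 | h5
        · exact le_max_of_le_left (by linarith)
        · exact le_max_of_le_right (by linarith)
      · by_contra hcon
        rw [not_disjoint_openSq] at hcon
        obtain ⟨_, ⟨_, h7⟩, _, h8⟩ := hcon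
        rcases max_cases (p.1 - q.1) (p.2 - q.2) with h | h <;> linarith
  -- `A` crosses the left side and `B` the bottom; index `1` marks protrusion past the far corner of
  -- that side. If `p` itself is in `O`, it falls in `A₀`.
  · set O := J.filter fun q => ¬ Disjoint (openSq q (r q)) (openSq p a) with hO
    set A := O.filter fun q => q.1 ≤ p.1 ∧ p.2 ≤ q.2 with hA
    set B := O.filter fun q => ¬ (q.1 ≤ p.1 ∧ p.2 ≤ q.2) with hB
    set A₀ := A.filter fun q => q.2 + r q ≤ p.2 + a with hA₀
    set A₁ := A.filter fun q => ¬ (q.2 + r q ≤ p.2 + a) with hA₁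
    set B₀ := B.filter fun q => q.1 + r q ≤ p.1 + a with hB₀
    set B₁ := B.filter fun q => ¬ (q.1 + r q ≤ p.1 + a) with hB₁
    have hOJ : O ⊆ J := Finset.filter_subset _ _
    have hAO : A ⊆ O := Finset.filter_subset _ _
    have hBO : B ⊆ O := Finset.filter_subset _ _
    have hA0A : A₀ ⊆ A := Finset.filter_subset _ _
    have hB0B : B₀ ⊆ B := Finset.filter_subset _ _
    have hA1A : A₁ ⊆ A := Finset.filter_subset _ _
    have hB1B : B₁ ⊆ B := Finset.filter_subset _ _
    have hOc : ∀ q ∈ O, (q.1 < p.1 + a ∧ p.1 < q.1 + r q ∧ q.2 < p.2 + a ∧ p.2 < q.2 + r q) ∧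
      ((q.1 ≤ p.1 ∧ p.2 ≤ q.2) ∨ (q.2 ≤ p.2 ∧ p.1 ≤ q.1)) := fun q h =>
        hover q (Finset.mem_filter.1 h).1 (Finset.mem_filter.1 h).2
    have hpos : ∀ q ∈ O, 0 < r q := fun q h =>
      (not_disjoint_openSq.1 (Finset.mem_filter.1 h).2).1.1
    have hAc : ∀ q ∈ A, q.1 ≤ p.1 ∧ p.2 ≤ q.2 := fun q h => (Finset.mem_filter.1 h).2
    have hBc : ∀ q ∈ B, q.2 ≤ p.2 ∧ p.1 ≤ q.1 := fun q h =>
      (hOc q (hBO h)).2.resolve_left (Finset.mem_filter.1 h).2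
    have hAr : ∀ q ∈ A, r q ^ 2 - r' q ^ 2 = r q ^ 2 - (p.1 - q.1) ^ 2 := by
      intro q h
      have := hAc q h
      simp only [hr', if_neg (Finset.mem_filter.1 (hAO h)).2]
      rw [max_eq_left (by linarith)]
    have hBr : ∀ q ∈ B, r q ^ 2 - r' q ^ 2 = r q ^ 2 - (p.2 - q.2) ^ 2 := by
      intro q h
      have := hBc q h
      simp only [hr', if_neg (Finset.mem_filter.1 (hBO h)).2]
      rw [max_eq_right (by linarith)]
    have hle : ∀ q ∈ O, r q ^ 2 - r' q ^ 2 ≤ a ^ 2 := by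
      intro q h
      have := pow_le_pow_left₀ (hr0 q (hOJ h)) (hra q (hOJ h)) 2
      linarith [sq_nonneg (r' q)]
    have hsum : ∑ q ∈ J, r q ^ 2 - ∑ q ∈ J, r' q ^ 2 =
        ∑ q ∈ A₀, (r q ^ 2 - r' q ^ 2) + ∑ q ∈ B₀, (r q ^ 2 - r' q ^ 2) +
        (∑ q ∈ A₁, (r q ^ 2 - r' q ^ 2) + ∑ q ∈ B₁, (r q ^ 2 - r' q ^ 2)) := by
      have e1 : ∑ q ∈ J, (r q ^ 2 - r' q ^ 2) = ∑ q ∈ O, (r q ^ 2 - r' q ^ 2) := by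
        refine (Finset.sum_subset hOJ fun q hqJ hqO => ?_).symm
        have : Disjoint (openSq q (r q)) (openSq p a) := by
          by_contra h
          exact hqO (Finset.mem_filter.2 ⟨hqJ, h⟩)
        simp only [hr', if_pos this, sub_self]
      rw [← Finset.sum_sub_distrib, e1,
        ← Finset.sum_filter_add_sum_filter_not O fun q => q.1 ≤ p.1 ∧ p.2 ≤ q.2,
        ← Finset.sum_filter_add_sum_filter_not A fun q => q.2 + r q ≤ p.2 + a,
        ← Finset.sum_filter_add_sum_filter_not B fun q => q.1 + r q ≤ p.1 + a]
      ring
    have hdO : ∀ q ∈ O, ∀ q' ∈ O,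
        ¬ Disjoint (openSq q (r q)) (openSq q' (r q')) → q = q' := by
      intro q h q' h' hnd
      by_contra hne
      exact hnd (hd (hOJ h) (hOJ h') hne)
    -- Each such square contains in its interior all points just to the right of the upper-left
    -- corner, so two of them would overlap.
    have h1 : ∑ q ∈ A₁, (r q ^ 2 - r' q ^ 2) ≤ a ^ 2 := by
      refine sum_le_of_card_le_one (sq_nonneg a) (fun q h q' h' => ?_)
        fun q h => hle q (hAO (hA1A h))
      have o := hAO (hA1A h)
      have o' := hAO (hA1A h')
      have c := hAc q (hA1A h)
      have c' := hAc q' (hA1A h')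
      have d := (Finset.mem_filter.1 h).2
      have d' := (Finset.mem_filter.1 h').2
      have e := (hOc q o).1
      have e' := (hOc q' o').1
      exact hdO q o q' o' (not_disjoint_openSq.2 ⟨⟨hpos q o, hpos q' o'⟩,
        ⟨by linarith, by linarith⟩, by linarith, by linarith⟩)
    have h2 : ∑ q ∈ B₁, (r q ^ 2 - r' q ^ 2) ≤ a ^ 2 := by
      refine sum_le_of_card_le_one (sq_nonneg a) (fun q h q' h' => ?_)
        fun q h => hle q (hBO (hB1B h))
      have o := hBO (hB1B h)
      have o' := hBO (hB1B h')
      have c := hBc q (hB1B h)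
      have c' := hBc q' (hB1B h')
      have d := (Finset.mem_filter.1 h).2
      have d' := (Finset.mem_filter.1 h').2
      have e := (hOc q o).1
      have e' := (hOc q' o').1
      exact hdO q o q' o' (not_disjoint_openSq.2 ⟨⟨hpos q o, hpos q' o'⟩,
        ⟨by linarith, by linarith⟩, by linarith, by linarith⟩)
    have hsub : A₀ ∪ B₀ ⊆ J :=
      Finset.union_subset (hA0A.trans (hAO.trans hOJ)) (hB0B.trans (hBO.trans hOJ))
    have h0 : ∑ q ∈ A₀, (r q ^ 2 - r' q ^ 2) + ∑ q ∈ B₀, (r q ^ 2 - r' q ^ 2) ≤ a ^ 2 := by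
      rw [Finset.sum_congr rfl fun q h => hAr q (hA0A h),
        Finset.sum_congr rfl fun q h => hBr q (hB0B h)]
      refine sum_sub_sq_le_sq ha
        ((Finset.disjoint_filter_filter_not O O _).mono hA0A hB0B)
        (hd.subset (Finset.coe_subset.2 hsub)) (fun q h => hra q (hsub h)) ?_ ?_
      · intro q h
        have c := hAc q (hA0A h)
        exact ⟨c.1, (hOc q (hAO (hA0A h))).1.2.1.le, c.2, (Finset.mem_filter.1 h).2⟩
      · intro q h
        have c := hBc q (hB0B h)
        exact ⟨c.1, (hOc q (hBO (hB0B h))).1.2.2.2.le, c.2, (Finset.mem_filter.1 h).2⟩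
    rw [hsum]
    linarith

/-! ### Packings as side-length functions, and existence of an optimum -/

/-- The side lengths `f` describe a lower-left anchored square packing for `P`. -/
structure IsSidePacking (P : Finset (ℝ × ℝ)) (f : ℝ × ℝ → ℝ) : Prop where
  nonneg : ∀ p ∈ P, 0 ≤ f p
  fst_le : ∀ p ∈ P, p.1 + f p ≤ 1
  snd_le : ∀ p ∈ P, p.2 + f p ≤ 1
  notMem : ∀ p ∈ P, ∀ q ∈ P, q ∉ openSq p (f p)
  disjoint : ∀ p ∈ P, ∀ q ∈ P, p ≠ q → Disjoint (openSq p (f p)) (openSq q (f q))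

theorem LLSquare.subset_unitSquare_iff {s : LLSquare} (h : s.anchor ∈ unitSquare) :
    s.toSet ⊆ unitSquare ↔ s.anchor.1 + s.side ≤ 1 ∧ s.anchor.2 + s.side ≤ 1 := by
  have h0 := s.side_nonneg
  obtain ⟨⟨h1, h2⟩, h3, h4⟩ := h
  constructor
  · intro hs
    have hm : ((s.anchor.1 + s.side, s.anchor.2 + s.side) : ℝ × ℝ) ∈ s.toSet :=
      ⟨⟨by simpa, le_rfl⟩, by simpa, le_rfl⟩
    exact ⟨(hs hm).1.2, (hs hm).2.2⟩
  · rintro ⟨h5, h6⟩ x ⟨⟨h7, h8⟩, h9, h10⟩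
    exact ⟨⟨h1.trans h7, h8.trans h5⟩, h3.trans h9, h10.trans h6⟩

theorem LLSquare.area_le_area_iff {s t : LLSquare} : s.area ≤ t.area ↔ s.side ≤ t.side :=
  pow_le_pow_iff_left₀ s.side_nonneg t.side_nonneg two_ne_zero

instance : Nonempty LLSquare := ⟨⟨0, 0, le_rfl⟩⟩

theorem IsLLPacking.exists_isSidePacking {P : Finset (ℝ × ℝ)} {S : Finset LLSquare}
    (h : IsLLPacking P S) (hP : ∀ p ∈ P, p ∈ unitSquare) :
    ∃ f, IsSidePacking P f ∧ (∀ p ∉ P, f p = 0) ∧ (∀ s ∈ S, f s.anchor = s.side) ∧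
      totalArea S = ∑ p ∈ P, f p ^ 2 := by
  classical
  choose! g hg hu using h.existsUnique
  have hgS : ∀ s ∈ S, g s.anchor = s := fun s hs =>
    (hu _ (h.anchor_mem s hs) s ⟨hs, rfl⟩).symm
  have hin : ∀ p ∈ P, p.1 + (g p).side ≤ 1 ∧ p.2 + (g p).side ≤ 1 := by
    intro p hp
    have := (LLSquare.subset_unitSquare_iff (s := g p) ((hg p hp).2.symm ▸ hP p hp)).1
      (h.subset_unitSquare _ (hg p hp).1)
    rwa [(hg p hp).2] at this
  refine ⟨fun p => if p ∈ P then (g p).side else 0, ⟨?_, ?_, ?_, ?_, ?_⟩, ?_, ?_, ?_⟩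
  · intro p hp
    simp only [if_pos hp]
    exact (g p).side_nonneg
  · intro p hp
    simp only [if_pos hp]
    exact (hin p hp).1
  · intro p hp
    simp only [if_pos hp]
    exact (hin p hp).2
  · intro p hp q hq
    have := h.isEmptyOf _ (hg p hp).1 q hq
    rw [LLSquare.interior_toSet, (hg p hp).2] at this
    simpa only [if_pos hp] using this
  · intro p hp q hq hne
    have hne' : g p ≠ g q := fun he => hne (by rw [← (hg p hp).2, he, (hg q hq).2])
    have := h.interiorDisjoint _ (hg p hp).1 _ (hg q hq).1 hne'
    rw [LLSquare.InteriorDisjoint, LLSquare.interior_toSet, LLSquare.interior_toSet, (hg p hp).2,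
      (hg q hq).2] at this
    simpa only [if_pos hp, if_pos hq] using this
  · intro p hp
    simp only [if_neg hp]
  · intro s hs
    simp only [if_pos (h.anchor_mem s hs), hgS s hs]
  · rw [totalArea]
    refine Finset.sum_bij' (fun s _ => s.anchor) (fun p _ => g p) h.anchor_mem
      (fun p hp => (hg p hp).1) hgS (fun p hp => (hg p hp).2) fun s hs => ?_
    simp only [if_pos (h.anchor_mem s hs), hgS s hs, LLSquare.area]

theorem IsSidePacking.exists_isLLPacking {P : Finset (ℝ × ℝ)} {f : ℝ × ℝ → ℝ}
    (h : IsSidePacking P f) (hP : ∀ p ∈ P, p ∈ unitSquare) :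
    ∃ S, IsLLPacking P S ∧ totalArea S = ∑ p ∈ P, f p ^ 2 := by
  classical
  -- The absolute value only makes `g` total; on `P` it changes nothing.
  set g : ℝ × ℝ → LLSquare := fun p => ⟨p, |f p|, abs_nonneg _⟩ with hg
  have habs : ∀ p ∈ P, |f p| = f p := fun p hp => abs_of_nonneg (h.nonneg p hp)
  refine ⟨P.image g, ⟨?_, ?_, ?_, ?_, ?_⟩, ?_⟩
  · intro s hs
    obtain ⟨p, hp, rfl⟩ := Finset.mem_image.1 hs
    exact hp
  · intro p hp
    refine ⟨g p, ⟨Finset.mem_image_of_mem g hp, rfl⟩, ?_⟩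
    rintro s ⟨hs, rfl⟩
    obtain ⟨q, hq, rfl⟩ := Finset.mem_image.1 hs
    rfl
  · intro s hs
    obtain ⟨p, hp, rfl⟩ := Finset.mem_image.1 hs
    rw [LLSquare.subset_unitSquare_iff (hP p hp)]
    simp only [hg, habs p hp]
    exact ⟨h.fst_le p hp, h.snd_le p hp⟩
  · intro s hs q hq
    obtain ⟨p, hp, rfl⟩ := Finset.mem_image.1 hs
    rw [LLSquare.interior_toSet]
    simp only [hg, habs p hp]
    exact h.notMem p hp q hq
  · intro s hs t ht hne
    obtain ⟨p, hp, rfl⟩ := Finset.mem_image.1 hs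
    obtain ⟨q, hq, rfl⟩ := Finset.mem_image.1 ht
    rw [LLSquare.InteriorDisjoint, LLSquare.interior_toSet, LLSquare.interior_toSet]
    simp only [hg, habs p hp, habs q hq]
    exact h.disjoint p hp q hq fun he => hne (by rw [he])
  · rw [totalArea, Finset.sum_image fun p _ q _ he => congrArg LLSquare.anchor he]
    simp only [hg, LLSquare.area, sq_abs]

theorem isClosed_setOf_notMem_openSq {X : Type*} [TopologicalSpace X] {f : X → ℝ}
    (hf : Continuous f) (p q : ℝ × ℝ) : IsClosed {x | q ∉ openSq p (f x)} := by
  have : IsOpen {x | q ∈ openSq p (f x)} := by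
    simp only [mem_openSq]
    exact ((isOpen_const.and (isOpen_lt continuous_const (by fun_prop))).and
      (isOpen_const.and (isOpen_lt continuous_const (by fun_prop))))
  exact this.isClosed_compl

/-- Overlap amounts to finitely many strict inequalities in the sides, hence is an open condition.
-/
theorem isClosed_setOf_disjoint_openSq {X : Type*} [TopologicalSpace X] {f g : X → ℝ}
    (hf : Continuous f) (hg : Continuous g) (p q : ℝ × ℝ) :
    IsClosed {x | Disjoint (openSq p (f x)) (openSq q (g x))} := by
  have : IsOpen {x | ¬ Disjoint (openSq p (f x)) (openSq q (g x))} := by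
    simp only [not_disjoint_openSq]
    refine IsOpen.and (IsOpen.and ?_ ?_) (IsOpen.and (IsOpen.and ?_ ?_) (IsOpen.and ?_ ?_)) <;>
    exact isOpen_lt (by fun_prop) (by fun_prop)
  simpa [Set.compl_ofPred] using this.isClosed_compl

theorem openSq_zero (p : ℝ × ℝ) : openSq p 0 = ∅ := by
  simp [openSq]

theorem isSidePacking_zero {P : Finset (ℝ × ℝ)} (hP : ∀ p ∈ P, p ∈ unitSquare) :
    IsSidePacking P 0 where
  nonneg _ _ := le_rfl
  fst_le p hp := by simpa using (hP p hp).1.2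
  snd_le p hp := by simpa using (hP p hp).2.2
  notMem p _ q _ := by simp [openSq_zero]
  disjoint p _ q _ _ := by simp [openSq_zero]

theorem isClosed_setOf_isSidePacking (P : Finset (ℝ × ℝ)) :
    IsClosed {f | IsSidePacking P f} := by
  have : {f | IsSidePacking P f} = {f : ℝ × ℝ → ℝ | (∀ p ∈ P, 0 ≤ f p) ∧
      (∀ p ∈ P, p.1 + f p ≤ 1) ∧ (∀ p ∈ P, p.2 + f p ≤ 1) ∧
      (∀ p ∈ P, ∀ q ∈ P, q ∉ openSq p (f p)) ∧
      ∀ p ∈ P, ∀ q ∈ P, p ≠ q → Disjoint (openSq p (f p)) (openSq q (f q))} := by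
    ext f
    exact ⟨fun h => ⟨h.1, h.2, h.3, h.4, h.5⟩, fun h => ⟨h.1, h.2.1, h.2.2.1, h.2.2.2.1, h.2.2.2.2⟩⟩
  rw [this]
  simp only [Set.ofPred_and, Set.ofPred_forall]
  refine IsClosed.inter ?_ (IsClosed.inter ?_ (IsClosed.inter ?_ (IsClosed.inter ?_ ?_)))
  · exact isClosed_biInter fun p _ => isClosed_le (by fun_prop) (by fun_prop)
  · exact isClosed_biInter fun p _ => isClosed_le (by fun_prop) (by fun_prop)
  · exact isClosed_biInter fun p _ => isClosed_le (by fun_prop) (by fun_prop)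
  · exact isClosed_biInter fun p _ => isClosed_biInter fun q _ =>
      isClosed_setOf_notMem_openSq (continuous_apply p) p q
  · exact isClosed_biInter fun p _ => isClosed_biInter fun q _ => isClosed_iInter fun _ =>
      isClosed_setOf_disjoint_openSq (continuous_apply p) (continuous_apply q) p q

theorem exists_isOptimalLLPacking {P : Finset (ℝ × ℝ)} (hP : ∀ p ∈ P, p ∈ unitSquare) :
    ∃ T, IsOptimalLLPacking P T := by
  -- Tychonoff on functions on the whole plane; coordinates off `P` do not affect the area, and a
  -- packing extended by `0` lies in the cube.
  have hK : IsCompact (Set.univ.pi (fun _ : ℝ × ℝ => Set.Icc (0 : ℝ) 1) ∩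
      {f | IsSidePacking P f}) :=
    (isCompact_univ_pi fun _ => isCompact_Icc).inter_right (isClosed_setOf_isSidePacking P)
  obtain ⟨f, hf, hmax⟩ := hK.exists_isMaxOn
    ⟨0, fun _ _ => ⟨le_rfl, zero_le_one⟩, isSidePacking_zero hP⟩
    (f := fun f : ℝ × ℝ → ℝ => ∑ p ∈ P, f p ^ 2) (by fun_prop)
  obtain ⟨T, hT, hTf⟩ := hf.2.exists_isLLPacking hP
  refine ⟨T, hT, fun T' hT' => ?_⟩
  obtain ⟨f', hf', hout, -, harea⟩ := hT'.exists_isSidePacking hP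
  rw [hTf, harea]
  refine hmax ⟨fun p _ => ?_, hf'⟩
  by_cases hp : p ∈ P
  · exact ⟨hf'.nonneg p hp, by linarith [hf'.fst_le p hp, (hP p hp).1.1]⟩
  · rw [hout p hp]
    exact ⟨le_rfl, zero_le_one⟩

/-! ### Candidates and runs of the greedy algorithm -/

theorem isAdmissible_iff {P : Finset (ℝ × ℝ)} {S : Finset LLSquare} {q : ℝ × ℝ} {s : LLSquare}
    (hq : q ∈ unitSquare) : IsAdmissible P S q s ↔ s.anchor = q ∧
      (q.1 + s.side ≤ 1 ∧ q.2 + s.side ≤ 1) ∧ (∀ p ∈ P, p ∉ openSq q s.side) ∧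
      ∀ t ∈ S, Disjoint (openSq q s.side) (openSq t.anchor t.side) := by
  constructor
  · rintro ⟨rfl, h2, h3, h4⟩
    refine ⟨rfl, (LLSquare.subset_unitSquare_iff hq).1 h2, fun p hp => ?_, fun t ht => ?_⟩
    · have := h3 p hp
      rwa [LLSquare.interior_toSet] at this
    · have := h4 t ht
      rwa [LLSquare.InteriorDisjoint, LLSquare.interior_toSet, LLSquare.interior_toSet] at this
  · rintro ⟨rfl, h2, h3, h4⟩
    refine ⟨rfl, (LLSquare.subset_unitSquare_iff hq).2 h2, fun p hp => ?_, fun t ht => ?_⟩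
    · rw [LLSquare.interior_toSet]
      exact h3 p hp
    · rw [LLSquare.InteriorDisjoint, LLSquare.interior_toSet, LLSquare.interior_toSet]
      exact h4 t ht

theorem exists_isCandidate (P : Finset (ℝ × ℝ)) (S : Finset LLSquare) {q : ℝ × ℝ}
    (hq : q ∈ unitSquare) : ∃ s, IsCandidate P S q s := by
  set K : Set ℝ := Set.Icc 0 1 ∩ ({r | q.1 + r ≤ 1} ∩ ({r | q.2 + r ≤ 1} ∩
    ({r | ∀ p ∈ P, p ∉ openSq q r} ∩
      {r | ∀ t ∈ S, Disjoint (openSq q r) (openSq t.anchor t.side)}))) with hKdef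
  have hK : IsCompact K := by
    refine isCompact_Icc.inter_right (IsClosed.inter (isClosed_le (by fun_prop) (by fun_prop))
      (IsClosed.inter (isClosed_le (by fun_prop) (by fun_prop)) (IsClosed.inter ?_ ?_)))
    · simp only [Set.ofPred_forall]
      exact isClosed_biInter fun p _ => isClosed_setOf_notMem_openSq continuous_id q p
    · simp only [Set.ofPred_forall]
      exact isClosed_biInter fun t _ =>
        isClosed_setOf_disjoint_openSq continuous_id continuous_const q t.anchor
  have h0 : (0 : ℝ) ∈ K :=
    ⟨⟨le_rfl, zero_le_one⟩, by simpa using hq.1.2, by simpa using hq.2.2,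
      by simp [openSq_zero], by simp [openSq_zero]⟩
  obtain ⟨r, hr, hmax⟩ := hK.exists_isMaxOn ⟨0, h0⟩ (f := fun r => r) (by fun_prop)
  refine ⟨⟨q, r, hr.1.1⟩, (isAdmissible_iff hq).2 ⟨rfl, ⟨hr.2.1, hr.2.2.1⟩, hr.2.2.2.1,
    hr.2.2.2.2⟩, fun s hs => ?_⟩
  obtain ⟨-, h2, h3, h4⟩ := (isAdmissible_iff hq).1 hs
  rw [LLSquare.area_le_area_iff]
  exact hmax ⟨⟨s.side_nonneg, by linarith [h2.1, hq.1.1]⟩, h2.1, h2.2, h3, h4⟩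

/-- A largest candidate is at least as large as any admissible square. -/
theorem side_le_of_isAdmissible {P Q : Finset (ℝ × ℝ)} {S : Finset LLSquare} {s t : LLSquare}
    {q : ℝ × ℝ} (hmax : ∀ q' ∈ Q, ∀ s', IsCandidate P S q' s' → s'.area ≤ s.area)
    (hq : q ∈ Q) (hqu : q ∈ unitSquare) (ht : IsAdmissible P S q t) : t.side ≤ s.side := by
  obtain ⟨c, hc⟩ := exists_isCandidate P S hqu
  exact LLSquare.area_le_area_iff.1 ((hc.2 t ht).trans (hmax q hq c hc))

theorem GreedyReaches.subset {P Q : Finset (ℝ × ℝ)} {S : Finset LLSquare}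
    (h : GreedyReaches P Q S) : Q ⊆ P := by
  induction h with
  | init => exact subset_rfl
  | step _ _ _ _ ih => exact (Finset.erase_subset _ _).trans ih

theorem GreedyReaches.exists_isGreedyOutput {P : Finset (ℝ × ℝ)}
    (hP : ∀ p ∈ P, p ∈ unitSquare) (n : ℕ) : ∀ {Q : Finset (ℝ × ℝ)} {S : Finset LLSquare},
    GreedyReaches P Q S → Q.card = n → ∃ S', IsGreedyOutput P S' := by
  classical
  induction n with
  | zero =>
    intro Q S h hQ
    rw [Finset.card_eq_zero] at hQ
    subst hQ
    exact ⟨S, h⟩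
  | succ n ih =>
    intro Q S h hQ
    have hne : Q.Nonempty := Finset.card_pos.1 (by omega)
    have hex : ∀ q ∈ Q, ∃ s, IsCandidate P S q s := fun q hq =>
      exists_isCandidate P S (hP q (h.subset hq))
    choose! c hc using hex
    obtain ⟨q, hq, hmax⟩ := Q.exists_max_image (fun q => (c q).area) hne
    have hstep := h.step hq (hc q hq) fun q' hq' s' hs' =>
      ((hc q' hq').2 s' hs'.1).trans (hmax q' hq')
    refine ih hstep ?_
    rw [Finset.card_erase_of_mem hq, hQ, Nat.add_sub_cancel]

/-- The squares placed so far form a packing for the processed points. -/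
theorem GreedyReaches.isPartialPacking {P Q : Finset (ℝ × ℝ)} {S : Finset LLSquare}
    (h : GreedyReaches P Q S) :
    (∀ s ∈ S, s.anchor ∈ P ∧ s.anchor ∉ Q) ∧
    (∀ p ∈ P, p ∉ Q → ∃! s, s ∈ S ∧ s.anchor = p) ∧
    (∀ s ∈ S, s.toSet ⊆ unitSquare) ∧ (∀ s ∈ S, s.IsEmptyOf P) ∧
    ∀ s ∈ S, ∀ t ∈ S, s ≠ t → s.InteriorDisjoint t := by
  induction h with
  | init => exact ⟨by simp, fun p hp hn => (hn hp).elim, by simp, by simp, by simp⟩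
  | @step Q S q s hr hq hc hmax ih =>
    obtain ⟨i1, i2, i3, i4, i5⟩ := ih
    have ha := hc.1.anchor_eq
    simp only [Finset.mem_insert, Finset.mem_erase, not_and]
    refine ⟨?_, ?_, ?_, ?_, ?_⟩
    · rintro t (rfl | ht)
      · exact ⟨ha ▸ hr.subset hq, fun hne => (hne ha).elim⟩
      · exact ⟨(i1 t ht).1, fun _ => (i1 t ht).2⟩
    · intro p hp hpQ
      by_cases hpq : p = q
      · subst hpq
        refine ⟨s, ⟨Or.inl rfl, ha⟩, ?_⟩
        rintro t ⟨rfl | ht, hta⟩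
        · rfl
        · exact ((i1 t ht).2 (hta ▸ hq)).elim
      · obtain ⟨t, ⟨ht, hta⟩, hu⟩ := i2 p hp (hpQ hpq)
        refine ⟨t, ⟨Or.inr ht, hta⟩, ?_⟩
        rintro t' ⟨rfl | ht', hta'⟩
        · exact (hpq (hta'.symm.trans ha)).elim
        · exact hu t' ⟨ht', hta'⟩
    · rintro t (rfl | ht)
      · exact hc.1.subset_unitSquare
      · exact i3 t ht
    · rintro t (rfl | ht)
      · exact hc.1.isEmptyOf
      · exact i4 t ht
    · rintro t (rfl | ht) t' (rfl | ht') hne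
      · exact (hne rfl).elim
      · exact hc.1.interiorDisjoint t' ht'
      · exact (hc.1.interiorDisjoint t ht).symm
      · exact i5 t ht t' ht' hne

theorem IsGreedyOutput.isLLPacking {P : Finset (ℝ × ℝ)} {S : Finset LLSquare}
    (h : IsGreedyOutput P S) : IsLLPacking P S := by
  obtain ⟨h1, h2, h3, h4, h5⟩ := GreedyReaches.isPartialPacking h
  exact ⟨fun s hs => (h1 s hs).1, fun p hp => h2 p hp (by simp), h3, h4, h5⟩

/-! ### The charging argument and the factor 3 -/

/-- At every stage of the greedy algorithm, the squares of a packing can be shrunk so as to avoid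
the chosen squares, at the cost of at most three times the area of the latter. -/
theorem GreedyReaches.exists_shrunk {P Q : Finset (ℝ × ℝ)} {S : Finset LLSquare}
    (hP : ∀ p ∈ P, p ∈ unitSquare) {f : ℝ × ℝ → ℝ} (hf : IsSidePacking P f)
    (h : GreedyReaches P Q S) :
    ∃ r : ℝ × ℝ → ℝ, (∀ q ∈ P, 0 ≤ r q ∧ r q ≤ f q) ∧ (∀ q ∈ P, q ∉ Q → r q = 0) ∧
      (∀ q ∈ P, ∀ t ∈ S, Disjoint (openSq q (r q)) (openSq t.anchor t.side)) ∧
      ∑ q ∈ P, f q ^ 2 - ∑ q ∈ P, r q ^ 2 ≤ 3 * totalArea S := by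
  classical
  induction h with
  | init =>
    exact ⟨f, fun q hq => ⟨hf.nonneg q hq, le_rfl⟩, fun q hq hn => (hn hq).elim, by simp,
      by simp [totalArea]⟩
  | @step Q S q s hr hq hc hmax ih =>
    obtain ⟨r, hrf, hrQ, hrS, hsum⟩ := ih
    have hqP := hr.subset hq
    have ha := hc.1.anchor_eq
    obtain ⟨-, -, hsP, -⟩ := (isAdmissible_iff (hP q hqP)).1 hc.1
    -- Greedy maximality enters here: unprocessed points carry admissible squares, and processed
    -- points carry side `0`.
    have hrs : ∀ p ∈ P, r p ≤ s.side := by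
      intro p hp
      by_cases hpQ : p ∈ Q
      · refine side_le_of_isAdmissible (t := ⟨p, r p, (hrf p hp).1⟩) hmax hpQ (hP p hp) ?_
        refine (isAdmissible_iff (hP p hp)).2 ⟨rfl, ⟨?_, ?_⟩, fun x hx hmem => ?_, hrS p hp⟩
        · linarith [hf.fst_le p hp, (hrf p hp).2]
        · linarith [hf.snd_le p hp, (hrf p hp).2]
        · exact hf.notMem p hp x hx (openSq_mono (hrf p hp).2 hmem)
      · rw [hrQ p hp hpQ]
        exact s.side_nonneg
    obtain ⟨r', hr', hr'sum⟩ := exists_shrink (p := q) (J := P) (r := r) s.side_nonneg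
      (fun p hp => (hrf p hp).1) hrs
      (fun p hp p' hp' hne => (hf.disjoint p hp p' hp' hne).mono (openSq_mono (hrf p hp).2)
        (openSq_mono (hrf p' hp').2))
      (fun p hp hmem => hf.notMem p hp q hqP (openSq_mono (hrf p hp).2 hmem)) hsP
    refine ⟨r', fun p hp => ⟨(hr' p hp).1, (hr' p hp).2.1.trans (hrf p hp).2⟩, ?_, ?_, ?_⟩
    · intro p hp hpQ
      rw [Finset.mem_erase, not_and] at hpQ
      by_cases hpq : p = q
      · subst hpq
        obtain ⟨h1, h2, h3⟩ := hr' p hp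
        -- A positive square at `p` would overlap the greedy square just placed with the same
        -- anchor.
        by_contra hne
        have hpos : 0 < r' p := lt_of_le_of_ne h1 (Ne.symm hne)
        have := hrs p hp
        exact not_disjoint_openSq.2 ⟨⟨hpos, by linarith⟩, ⟨by linarith, by linarith⟩,
          by linarith, by linarith⟩ h3
      · have := hrQ p hp (hpQ hpq)
        have := hr' p hp
        linarith
    · intro p hp t ht
      simp only [Finset.mem_insert] at ht
      rcases ht with rfl | ht
      · rw [ha]
        exact (hr' p hp).2.2
      · exact (hrS p hp t ht).mono_left (openSq_mono (hr' p hp).2.1)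
    -- `S` is a set, so its area grows by `s.area` only if `s` is new.
    · have hsS : s ∉ S := fun hs => (hr.isPartialPacking.1 s hs).2 (ha ▸ hq)
      rw [totalArea, Finset.sum_insert hsS, ← totalArea, LLSquare.area]
      linarith

theorem IsGreedyOutput.totalArea_ge {P : Finset (ℝ × ℝ)} {S T : Finset LLSquare}
    (hP : ∀ p ∈ P, p ∈ unitSquare) (h : IsGreedyOutput P S) (hT : IsLLPacking P T) :
    totalArea T ≤ 3 * totalArea S := by
  obtain ⟨f, hf, -, -, harea⟩ := hT.exists_isSidePacking hP
  obtain ⟨r, -, hr0, -, hsum⟩ := GreedyReaches.exists_shrunk hP hf h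
  rw [Finset.sum_eq_zero (f := fun q => r q ^ 2) fun q hq => by simp [hr0 q hq]] at hsum
  linarith

/-! ### Sharpness of the constant -/

/-- The lower-left corners of three of the four quadrants of the unit square. -/
noncomputable def quadrantCorners : Finset (ℝ × ℝ) := {(0, 0), (0, 1 / 2), (1 / 2, 0)}

/-- The `N - 1` points that divide the diagonal of the upper right quadrant into `N` parts of
width `η = 1 / (2 * N)`. -/
noncomputable def diagonalPoints (N : ℕ) (η : ℝ) : Finset (ℝ × ℝ) :=
  (Finset.Ico 1 N).image fun i : ℕ => (1 / 2 + i * η, 1 / 2 + i * η)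

theorem mem_quadrantCorners {p : ℝ × ℝ} :
    p ∈ quadrantCorners ↔ p = (0, 0) ∨ p = (0, 1 / 2) ∨ p = (1 / 2, 0) := by
  simp [quadrantCorners]

theorem mem_diagonalPoints {N : ℕ} {η : ℝ} {p : ℝ × ℝ} :
    p ∈ diagonalPoints N η ↔ ∃ i : ℕ, (1 ≤ i ∧ i < N) ∧ (1 / 2 + i * η, 1 / 2 + i * η) = p := by
  simp [diagonalPoints]

/-- The points for which the greedy algorithm performs badly. -/
noncomputable def badPoints (N : ℕ) (η : ℝ) : Finset (ℝ × ℝ) :=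
  quadrantCorners ∪ diagonalPoints N η

theorem diagonalPoints_bounds {N : ℕ} {η : ℝ} (hη : 0 < η) (hN : N * η = 1 / 2) {p : ℝ × ℝ}
    (hp : p ∈ diagonalPoints N η) :
    (1 / 2 + η ≤ p.1 ∧ p.1 ≤ 1) ∧ (1 / 2 + η ≤ p.2 ∧ p.2 ≤ 1) := by
  obtain ⟨i, ⟨h1, h2⟩, rfl⟩ := mem_diagonalPoints.1 hp
  have h3 : (1 : ℝ) * η ≤ i * η := by gcongr; exact_mod_cast h1
  have h4 : (i : ℝ) * η ≤ N * η := by gcongr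
  refine ⟨⟨?_, ?_⟩, ?_, ?_⟩ <;> dsimp only <;> linarith

theorem badPoints_subset_unitSquare {N : ℕ} {η : ℝ} (hη : 0 < η) (hN : N * η = 1 / 2) :
    ∀ p ∈ badPoints N η, p ∈ unitSquare := by
  intro p hp
  rcases Finset.mem_union.1 hp with hp | hp
  · rcases mem_quadrantCorners.1 hp with rfl | rfl | rfl <;>
      refine ⟨⟨?_, ?_⟩, ?_, ?_⟩ <;> norm_num
  · have := diagonalPoints_bounds hη hN hp
    refine ⟨⟨?_, ?_⟩, ?_, ?_⟩ <;> linarith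

theorem half_le_of_mem_badPoints {N : ℕ} {η : ℝ} (hη : 0 < η) (hN : N * η = 1 / 2) {p : ℝ × ℝ}
    (hp : p ∈ badPoints N η) (h0 : p ≠ (0, 0)) : 1 / 2 ≤ p.1 ∨ 1 / 2 ≤ p.2 := by
  rcases Finset.mem_union.1 hp with hp | hp
  · rcases mem_quadrantCorners.1 hp with rfl | rfl | rfl
    · exact (h0 rfl).elim
    · exact Or.inr le_rfl
    · exact Or.inl le_rfl
  · have := diagonalPoints_bounds hη hN hp
    exact Or.inl (by linarith)

/-- The diagonal points lie strictly inside the fourth quadrant or beyond the other three, so they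
do not obstruct these squares. This packing witnesses that the optimum is at least `3 / 4`. -/
theorem isSidePacking_quadrants {N : ℕ} {η : ℝ} (hη : 0 < η) (hN : N * η = 1 / 2) :
    IsSidePacking (badPoints N η) fun p => open Classical in
      if p ∈ quadrantCorners then 1 / 2 else 0 where
  nonneg p _ := by split_ifs <;> norm_num
  fst_le p hp := by
    split_ifs with h
    · rcases mem_quadrantCorners.1 h with rfl | rfl | rfl <;> norm_num
    · simpa using (badPoints_subset_unitSquare hη hN p hp).1.2
  snd_le p hp := by
    split_ifs with h
    · rcases mem_quadrantCorners.1 h with rfl | rfl | rfl <;> norm_num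
    · simpa using (badPoints_subset_unitSquare hη hN p hp).2.2
  notMem p hp q hq := by
    split_ifs with h
    · rw [mem_openSq]
      rcases Finset.mem_union.1 hq with hq | hq
      · rcases mem_quadrantCorners.1 h with rfl | rfl | rfl <;>
          rcases mem_quadrantCorners.1 hq with rfl | rfl | rfl <;> norm_num
      · have := diagonalPoints_bounds hη hN hq
        rcases mem_quadrantCorners.1 h with rfl | rfl | rfl <;>
          (rintro ⟨⟨h1, h2⟩, h3, h4⟩; norm_num at h1 h2 h3 h4; linarith)
    · simp [openSq_zero]
  disjoint p hp q hq hne := by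
    by_cases h : p ∈ quadrantCorners
    · by_cases h' : q ∈ quadrantCorners
      · rw [if_pos h, if_pos h']
        by_contra hcon
        rw [not_disjoint_openSq] at hcon
        rcases mem_quadrantCorners.1 h with rfl | rfl | rfl <;>
          rcases mem_quadrantCorners.1 h' with rfl | rfl | rfl <;>
          first
          | exact hne rfl
          | norm_num at hcon
      · simp [if_neg h', openSq_zero]
    · simp [if_neg h, openSq_zero]

theorem IsOptimalLLPacking.three_quarters_le {N : ℕ} {η : ℝ} (hη : 0 < η) (hN : N * η = 1 / 2)
    {T : Finset LLSquare} (hT : IsOptimalLLPacking (badPoints N η) T) : 3 / 4 ≤ totalArea T := by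
  classical
  obtain ⟨T', hT', harea⟩ := (isSidePacking_quadrants hη hN).exists_isLLPacking
    (badPoints_subset_unitSquare hη hN)
  refine le_trans ?_ (hT.2 T' hT')
  rw [harea]
  refine le_trans ?_ (Finset.sum_le_sum_of_subset_of_nonneg
    (Finset.subset_union_left : quadrantCorners ⊆ badPoints N η) fun _ _ _ => sq_nonneg _)
  rw [Finset.sum_congr rfl fun p hp => by rw [if_pos hp], Finset.sum_const,
    show quadrantCorners.card = 3 by simp [quadrantCorners]]
  norm_num

/-- On `badPoints` the greedy algorithm first chooses a square of side `1 / 2 + η` at the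
origin. -/
theorem GreedyReaches.exists_square_at_origin {N : ℕ} {η : ℝ} (hη : 0 < η) (hN : N * η = 1 / 2)
    (hN2 : 2 ≤ N) {Q : Finset (ℝ × ℝ)} {S : Finset LLSquare}
    (h : GreedyReaches (badPoints N η) Q S) :
    (Q = badPoints N η ∧ S = ∅) ∨ ∃ s ∈ S, s.anchor = (0, 0) ∧ s.side = 1 / 2 + η := by
  classical
  have hu := badPoints_subset_unitSquare hη hN
  have h0 : ((0, 0) : ℝ × ℝ) ∈ badPoints N η :=
    Finset.mem_union_left _ (mem_quadrantCorners.2 (Or.inl rfl))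
  have h1 : ((1 / 2 + η, 1 / 2 + η) : ℝ × ℝ) ∈ badPoints N η :=
    Finset.mem_union_right _ (mem_diagonalPoints.2 ⟨1, ⟨le_rfl, hN2⟩, by norm_num⟩)
  have hη1 : η ≤ 1 / 2 := by
    have : (1 : ℝ) * η ≤ N * η := by gcongr; exact_mod_cast (by omega : 1 ≤ N)
    linarith
  induction h with
  | init => exact Or.inl ⟨rfl, rfl⟩
  | @step Q S q s hr hq hc hmax ih =>
    right
    rcases ih with ⟨rfl, rfl⟩ | ⟨t, ht, hta⟩
    · obtain ⟨ha, ⟨hs1, hs2⟩, hemp, -⟩ := (isAdmissible_iff (hu q hq)).1 hc.1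
      have hlarge : 1 / 2 + η ≤ s.side := by
        refine side_le_of_isAdmissible (t := ⟨(0, 0), 1 / 2 + η, by linarith⟩) hmax h0 (hu _ h0) ?_
        refine (isAdmissible_iff (hu _ h0)).2 ⟨rfl, ⟨?_, ?_⟩, fun p hp hmem => ?_, by simp⟩
        · dsimp only; linarith
        · dsimp only; linarith
        · rw [mem_openSq] at hmem
          obtain ⟨⟨m1, m2⟩, m3, m4⟩ := hmem
          dsimp only at m1 m2 m3 m4
          rcases Finset.mem_union.1 hp with hp | hp
          · rcases mem_quadrantCorners.1 hp with rfl | rfl | rfl <;> simp at m1 m3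
          · have := diagonalPoints_bounds hη hN hp
            linarith
      -- Any other point has a coordinate at least `1 / 2`, so its square has side at most `1 / 2`;
      -- no tie with the origin is possible.
      have hq0 : q = (0, 0) := by
        by_contra hne
        rcases half_le_of_mem_badPoints hη hN hq hne with h | h <;> linarith
      subst hq0
      refine ⟨s, by simp, ha, le_antisymm ?_ hlarge⟩
      -- A larger square would contain the first diagonal point, which exists because `2 ≤ N`.
      by_contra hcon
      refine hemp _ h1 ⟨⟨?_, ?_⟩, ?_, ?_⟩ <;> dsimp only <;> linarith
    · exact ⟨t, by simp [ht], hta⟩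

theorem IsGreedyOutput.totalArea_badPoints_le {N : ℕ} {η : ℝ} (hη : 0 < η) (hN : N * η = 1 / 2)
    (hN2 : 2 ≤ N) {S : Finset LLSquare} (h : IsGreedyOutput (badPoints N η) S) :
    totalArea S ≤ 1 / 4 + 3 * η := by
  classical
  obtain ⟨f, hf, -, hfS, harea⟩ :=
    h.isLLPacking.exists_isSidePacking (badPoints_subset_unitSquare hη hN)
  have h0 : ((0, 0) : ℝ × ℝ) ∈ badPoints N η :=
    Finset.mem_union_left _ (mem_quadrantCorners.2 (Or.inl rfl))
  have hf0 : f (0, 0) = 1 / 2 + η := by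
    rcases GreedyReaches.exists_square_at_origin hη hN hN2 h with ⟨h1, -⟩ | ⟨s, hs, ha, hside⟩
    · rw [← h1] at h0
      simp at h0
    · rw [← ha, hfS s hs, hside]
  -- The two remaining quadrant corners are blocked by the square at the origin, and each diagonal
  -- point by the next one. The bound `η` is crude for the corners, but suffices.
  have hsmall : ∀ p ∈ (badPoints N η).erase (0, 0), f p ^ 2 ≤ η ^ 2 := by
    intro p hp
    obtain ⟨hne, hp⟩ := Finset.mem_erase.1 hp
    refine pow_le_pow_left₀ (hf.nonneg p hp) ?_ 2
    have hdis := hf.disjoint p hp _ h0 hne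
    rcases Finset.mem_union.1 hp with hp' | hp'
    · by_contra hcon
      refine not_disjoint_openSq.2 ⟨⟨by linarith, by linarith⟩, ?_⟩ hdis
      rw [hf0]
      rcases mem_quadrantCorners.1 hp' with rfl | rfl | rfl
      · exact (hne rfl).elim
      · refine ⟨⟨?_, ?_⟩, ?_, ?_⟩ <;> dsimp only at * <;> linarith
      · refine ⟨⟨?_, ?_⟩, ?_, ?_⟩ <;> dsimp only at * <;> linarith
    · obtain ⟨i, ⟨hi1, hi2⟩, rfl⟩ := mem_diagonalPoints.1 hp'
      rcases Nat.lt_or_ge (i + 1) N with hi | hi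
      · have hmem : ((1 / 2 + ((i + 1 : ℕ) : ℝ) * η, 1 / 2 + ((i + 1 : ℕ) : ℝ) * η) : ℝ × ℝ) ∈
            badPoints N η :=
          Finset.mem_union_right _ (mem_diagonalPoints.2 ⟨i + 1, ⟨by omega, hi⟩, rfl⟩)
        by_contra hcon
        refine hf.notMem _ hp _ hmem ⟨⟨?_, ?_⟩, ?_, ?_⟩ <;> push_cast <;> linarith
      -- The last diagonal point is stopped by the boundary of the unit square instead.
      · obtain rfl : N = i + 1 := by omega
        have := hf.fst_le _ hp
        push_cast at hN
        dsimp only at this ⊢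
        linarith
  have hcard : ((badPoints N η).erase (0, 0)).card ≤ N + 1 := by
    have h1 : (badPoints N η).card ≤ 3 + (N - 1) :=
      (Finset.card_union_le _ _).trans (add_le_add Finset.card_le_three
        (Finset.card_image_le.trans (by simp)))
    rw [Finset.card_erase_of_mem h0]
    omega
  have hcard' : (((badPoints N η).erase (0, 0)).card : ℝ) ≤ N + 1 := by exact_mod_cast hcard
  have hN2' : (2 : ℝ) ≤ N := by exact_mod_cast hN2
  have hsum := Finset.sum_le_card_nsmul _ _ _ hsmall
  rw [nsmul_eq_mul] at hsum
  rw [harea, ← Finset.add_sum_erase _ _ h0, hf0]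
  -- Since `N * η = 1 / 2`, the bound `(1 / 2 + η) ^ 2 + (N + 1) * η ^ 2` equals `1 / 4 + 3 / 2 * η
  -- + 2 * η ^ 2`, and `η ≤ 1 / 4`.
  nlinarith [mul_le_mul_of_nonneg_right hcard' (sq_nonneg η)]

theorem mainTheorem6 :
    (∀ P : Finset (ℝ × ℝ), (∀ p ∈ P, p ∈ unitSquare) →
      (∃ S, IsGreedyOutput P S) ∧
      (∃ T, IsOptimalLLPacking P T) ∧
      ∀ S, IsGreedyOutput P S →
        IsLLPacking P S ∧
        ∀ T, IsOptimalLLPacking P T → (1 / 3 : ℝ) * totalArea T ≤ totalArea S) ∧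
    (∀ ε : ℝ, 0 < ε →
      ∃ P : Finset (ℝ × ℝ), (∀ p ∈ P, p ∈ unitSquare) ∧
        ∀ S, IsGreedyOutput P S → ∀ T, IsOptimalLLPacking P T →
          totalArea S < (1 / 3 + ε) * totalArea T) := by
  refine ⟨fun P hP => ⟨GreedyReaches.init.exists_isGreedyOutput hP _ rfl,
    exists_isOptimalLLPacking hP, fun S hS => ⟨hS.isLLPacking, fun T hT => ?_⟩⟩, fun ε hε => ?_⟩
  · linarith [hS.totalArea_ge hP hT.1]
  · obtain ⟨n, hn⟩ := exists_nat_gt (2 / ε)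
    have hpos : (0 : ℝ) < (n + 2 : ℕ) := by positivity
    have hη : 0 < 1 / (2 * ((n + 2 : ℕ) : ℝ)) := by positivity
    have hN : ((n + 2 : ℕ) : ℝ) * (1 / (2 * ((n + 2 : ℕ) : ℝ))) = 1 / 2 := by field_simp
    -- The threshold `ε / 4` comes from `1 / 4 + 3 * η < (1 / 3 + ε) * (3 / 4)`.
    have hsmall : 1 / (2 * ((n + 2 : ℕ) : ℝ)) < ε / 4 := by
      rw [div_lt_iff₀ hε] at hn
      rw [div_lt_div_iff₀ (by positivity) (by norm_num)]
      push_cast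
      linarith
    refine ⟨badPoints (n + 2) (1 / (2 * ((n + 2 : ℕ) : ℝ))), badPoints_subset_unitSquare hη hN,
      fun S hS T hT => ?_⟩
    have h1 := hS.totalArea_badPoints_le hη hN (by omega)
    have h2 := hT.three_quarters_le hη hN
    nlinarith
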